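/- All graphs are finite, undirected and simple. For a graph $F$, let $\alpha(F)$ be its independence number and $\mu(F)$ its matching number; $F$ is König--Egerváry if $\alpha(F)+\mu(F)=|V(F)|$, and almost bipartite if it has exactly one odd cycle. Let $D(F)$ be the set of vertices missed by some maximum matching of $F$, $A(F)$ the set of vertices outside $D(F)$ that have a neighbour in $D(F)$, and $C(F)=V(F)\setminus(D(F)\cup A(F))$. For a matching $M$ of $F$, an $M$-blossom is a cycle of length $2m+1$ with $m$ edges in $M$; its base is the vertex of the cycle that is not covered by these $m$ edges. An $M$-stem of the blossom is an $M$-alternating path of even (possibly zero) length from the base to a vertex not saturated by $M$, meeting the blossom only in the base. A blossom together with a stem is an $M$-flower. For an odd cycle $O$ of $F$, the set $R(O)$ is the union of the vertex sets of all $M$-flowers of $F$ with blossom $O$, over all maximum matchings $M$ of $F$. Let $B,G_1,\dots,G_k$ be pairwise disjoint graphs such that $B$ is bipartite (possibly empty) and each $G_i$ is an almost bipartite non-König--Egerváry graph whose unique odd cycle $O_i$ satisfies $R(O_i)=V(G_i)$. Let $G$ be obtained from the disjoint union $B\cup G_1\cup\dots\cup G_k$ by adding edges between vertices belonging to different graphs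 in such a way that every vertex of $B$ with a neighbour outside $V(B)$ lies in $A(B)\cup C(B)$, and, for each $i$, every vertex of $G_i$ with a neighbour outside $V(G_i)$ lies in $A(G_i)$. Such a graph is called a BAB-graph and is denoted by $G=(B,G_1,\dots,G_k)$. A Sachs subgraph of $G$ is a spanning subgraph of $G$ each of whose connected components is a $K_2$ or a cycle. \textbf{Theorem.} Let $G=(B,G_1,\dots,G_k)$ be a BAB-graph and let $H$ be a Sachs subgraph of $G$. If $H'$ is a connected component of $H$, then either $V(H')\subseteq V(B)$ or $V(H')\subseteq V(G_i)$ for some $i\in\{1,\dots,k\}$. -/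

import Mathlib

namespace BABGraph

open SimpleGraph

section Matchings

/-- `M` is a matching of `G` with the largest possible number of edges.
The vertices saturated by `M` are those in `M.verts`. -/
def IsMaximumMatching {V : Type*} {G : SimpleGraph V} (M : G.Subgraph) : Prop :=
  M.IsMatching ∧ ∀ N : G.Subgraph, N.IsMatching → N.edgeSet.ncard ≤ M.edgeSet.ncard

/-- The matching number `μ(G)`. -/
noncomputable def matchingNumber {V : Type*} (G : SimpleGraph V) : ℕ :=
  sSup {n : ℕ | ∃ M : G.Subgraph, M.IsMatching ∧ M.edgeSet.ncard = n}

/-- König–Egerváry graphs: `α(G) + μ(G) = |V(G)|`. -/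
def IsKonigEgervary {V : Type*} (G : SimpleGraph V) : Prop :=
  G.indepNum + matchingNumber G = Nat.card V

end Matchings

section GallaiEdmonds

/-- Gallai–Edmonds set `D(G)`: vertices missed by some maximum matching. -/
def geD {V : Type*} (G : SimpleGraph V) : Set V :=
  {v | ∃ M : G.Subgraph, IsMaximumMatching M ∧ v ∉ M.verts}

/-- Gallai–Edmonds set `A(G)`: vertices outside `D(G)` with a neighbour in `D(G)`. -/
def geA {V : Type*} (G : SimpleGraph V) : Set V :=
  {v | v ∉ geD G ∧ ∃ u ∈ geD G, G.Adj v u}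

/-- Gallai–Edmonds set `C(G)`: all remaining vertices. -/
def geC {V : Type*} (G : SimpleGraph V) : Set V :=
  (geD G ∪ geA G)ᶜ

end GallaiEdmonds

section OddCycles

/-- The subgraph `C` of `G` is a cycle of odd length. -/
def IsOddCycle {V : Type*} {G : SimpleGraph V} (C : G.Subgraph) : Prop :=
  ∃ (v : V) (c : G.Walk v v), c.IsCycle ∧ Odd c.length ∧ c.toSubgraph = C

/-- A graph is almost bipartite if it has exactly one odd cycle
(cycles being counted as subgraphs). -/
def IsAlmostBipartite {V : Type*} (G : SimpleGraph V) : Prop :=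
  ∃! C : G.Subgraph, IsOddCycle C

/-- A walk is `M`-alternating if of any two consecutive edges exactly one belongs to `M`. -/
def IsAlternatingWalk {V : Type*} {G : SimpleGraph V} (M : G.Subgraph) {u v : V}
    (p : G.Walk u v) : Prop :=
  p.edges.IsChain fun e f => e ∈ M.edgeSet ↔ f ∉ M.edgeSet

/-- `c` is an `M`-blossom with base `b`: a cycle of length `2m + 1` with `m` edges in `M`,
where `b` is the vertex of the cycle not covered by these `m` edges. -/
structure IsBlossom {V : Type*} {G : SimpleGraph V} (M : G.Subgraph) {b : V}
    (c : G.Walk b b) : Prop where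
  isCycle : c.IsCycle
  length_eq : c.length = 2 * {e | e ∈ c.edges ∧ e ∈ M.edgeSet}.ncard + 1
  base : ∀ e ∈ c.edges, b ∈ e → e ∉ M.edgeSet

/-- An `M`-flower: an `M`-blossom `c` with base `b`, and an `M`-stem `p`, i.e. an `M`-alternating
path of even (possibly zero) length from `b` to a vertex `r` not saturated by `M`,
which meets the blossom only in `b`. -/
structure IsFlower {V : Type*} {G : SimpleGraph V} (M : G.Subgraph) {b r : V}
    (c : G.Walk b b) (p : G.Walk b r) : Prop where
  blossom : IsBlossom M c
  isPath : p.IsPath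
  alternating : IsAlternatingWalk M p
  even_length : Even p.length
  root : r ∉ M.verts
  inter : ∀ v, v ∈ c.support → v ∈ p.support → v = b

/-- The reach set `R(C)`: the union of the vertex sets of all `M`-flowers with blossom `C`,
over all maximum matchings `M`. -/
def reachSet {V : Type*} {G : SimpleGraph V} (C : G.Subgraph) : Set V :=
  {v | ∃ M : G.Subgraph, IsMaximumMatching M ∧
    ∃ (b r : V) (c : G.Walk b b) (p : G.Walk b r),
      IsFlower M c p ∧ c.toSubgraph = C ∧ (v ∈ c.support ∨ v ∈ p.support)}

end OddCycles

section BAB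

/-- The vertices of `S` having a neighbour outside `S`. -/
def boundary {V : Type*} (G : SimpleGraph V) (S : Set V) : Set V :=
  {v | v ∈ S ∧ ∃ w, w ∉ S ∧ G.Adj v w}

/-- `G` is the BAB-graph `(B, G₁, …, Gₖ)`, where `B` and the `Gᵢ` are the subgraphs of `G`
induced by the vertex sets `VB` and `VG i`. As edges are only added between different pieces,
`G` arises from the disjoint union of the pieces exactly when the pieces are the subgraphs
induced by the parts of a partition of the vertex set (parts of which `VB` may be empty). -/
structure IsBAB {V : Type*} (G : SimpleGraph V) {k : ℕ} (VB : Set V) (VG : Fin k → Set V) :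
    Prop where
  disjoint_base : ∀ i, Disjoint VB (VG i)
  disjoint_parts : ∀ i j, i ≠ j → Disjoint (VG i) (VG j)
  cover : VB ∪ ⋃ i, VG i = Set.univ
  bipartite : (G.induce VB).IsBipartite
  almostBipartite : ∀ i, IsAlmostBipartite (G.induce (VG i))
  not_konigEgervary : ∀ i, ¬ IsKonigEgervary (G.induce (VG i))
  reach : ∀ i, ∀ C : (G.induce (VG i)).Subgraph, IsOddCycle C → reachSet C = Set.univ
  boundary_base : boundary G VB ⊆ Subtype.val '' (geA (G.induce VB) ∪ geC (G.induce VB))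
  boundary_parts : ∀ i, boundary G (VG i) ⊆ Subtype.val '' geA (G.induce (VG i))

/-- A Sachs subgraph of `G`: a spanning subgraph, i.e. a graph `H ≤ G` on all vertices of `G`,
each of whose connected components is a `K₂` or a cycle. -/
def IsSachs {V : Type*} (G H : SimpleGraph V) : Prop :=
  H ≤ G ∧ ∀ K : H.ConnectedComponent,
    Nonempty (K.toSimpleGraph ≃g completeGraph (Fin 2)) ∨
      ∃ n : ℕ, 3 ≤ n ∧ Nonempty (K.toSimpleGraph ≃g cycleGraph n)

end BAB

end BABGraph

/-!
Let `O` be the odd cycle of a part `G`. Since `O` is the only one, deleting its edges leaves a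
bipartite graph in which no two vertices of `O` are connected, hence one with a 2-colouring that
puts `O` into a single class. Let `Y` be the other class. As flowers cover `G`, every vertex outside
`Y` can be exposed by a maximum matching: shift the matching along the stem, or rotate it around
`O`; thus `A(G) ⊆ Y`. On the other hand a maximum matching that exposes a vertex of `O` and maps `O`
to itself saturates `Y`. Otherwise it misses some `y ∈ Y`, while another maximum matching misses the
neighbour of `y` on the stem of a flower through `y`, and gluing the two yields a maximum matching
that misses two adjacent vertices. That matching therefore sends `Y` injectively into the
set `I` of vertices outside `Y` and `O`, so `|Y| ≤ |I|`, whereas all neighbours of `I` lie in `Y`.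

Weight the edges of a Sachs subgraph by their inverse degree. The resulting matrix is doubly
stochastic, and the inequality `|Y| ≤ |I|` leaves no weight for edges between `Y` and vertices
outside `I`. So no edge leaves the part through `A(G) ⊆ Y`.
-/

namespace BABGraph

open SimpleGraph Function

section Parity

variable {V : Type*} {G : SimpleGraph V}

theorem even_length_bypass_iff [DecidableEq V]
    (hG : ∀ (w : V) (c : G.Walk w w), c.IsCycle → Even c.length) {u v : V} (p : G.Walk u v) :
    Even p.bypass.length ↔ Even p.length := by
  induction p with
  | nil => rfl
  | @cons u x v h p ih =>
    by_cases hu : u ∈ p.bypass.support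
    · have hpath := p.bypass_isPath.takeUntil hu
      have hodd : ¬ Even (p.bypass.takeUntil u hu).length := by
        intro heven
        have hcycle := (Walk.cons_isCycle_iff _ h).2 ⟨hpath, fun hmem => by
          have hone := hpath.length_eq_one_of_mem_edges (Sym2.eq_swap ▸ hmem)
          exact absurd heven (by simp [hone])⟩
        have := hG u _ hcycle
        rw [Walk.length_cons] at this
        grind
      have hsum := congrArg Walk.length (p.bypass.take_spec hu)
      rw [Walk.length_append] at hsum
      rw [Walk.bypass, dif_pos hu, Walk.length_cons]
      grind
    · rw [Walk.bypass, dif_neg hu, Walk.length_cons, Walk.length_cons, Nat.even_add_one,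
        Nat.even_add_one, ih]

theorem two_colorable_of_forall_isCycle_even
    (hG : ∀ (w : V) (c : G.Walk w w), c.IsCycle → Even c.length) : G.Colorable 2 := by
  classical
  refine two_colorable_iff_forall_loop_even.2 fun u p => ?_
  rw [← even_length_bypass_iff hG p, (Walk.isPath_iff_nil.1 p.bypass_isPath).eq_nil]
  exact Even.zero

theorem exists_coloring_eq_false (hG : G.Colorable 2) {S : Set V}
    (hS : ∀ s ∈ S, ∀ t ∈ S, G.Reachable s t → s = t) :
    ∃ c : G.Coloring Bool, ∀ s ∈ S, c s = false := by
  classical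
  let c : G.Coloring Bool := hG.toColoring (by simp)
  let flip (K : G.ConnectedComponent) : Bool :=
    decide (∃ s ∈ S, G.connectedComponentMk s = K ∧ c s = true)
  refine ⟨Coloring.mk (fun v => xor (c v) (flip (G.connectedComponentMk v))) ?_, fun s hs => ?_⟩
  · intro u v huv
    have hc := c.valid huv
    rw [ConnectedComponent.sound huv.reachable]
    simpa using hc
  · have hflip : flip (G.connectedComponentMk s) = c s := by
      rw [Bool.eq_iff_iff, decide_eq_true_iff]
      constructor
      · rintro ⟨t, ht, hts, hct⟩
        rwa [← hS t ht s hs (ConnectedComponent.exact hts)]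
      · exact fun hcs => ⟨s, hs, rfl, hcs⟩
    exact (congrArg _ hflip).trans (Bool.xor_self _)

end Parity

section AlmostBipartite

variable {V : Type*} {G : SimpleGraph V} {O : G.Subgraph}

theorem two_colorable_deleteEdges (hO : ∀ C : G.Subgraph, IsOddCycle C → C = O) {e : Sym2 V}
    (he : e ∈ O.edgeSet) : (G.deleteEdges {e}).Colorable 2 := by
  refine two_colorable_of_forall_isCycle_even fun w c hc => ?_
  by_contra hodd
  have hle : G.deleteEdges {e} ≤ G := deleteEdges_le _
  have hcO := hO (c.mapLe hle).toSubgraph ⟨w, c.mapLe hle, hc.mapLe hle,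
    by simpa only [Walk.length_map, Nat.not_even_iff_odd] using hodd, rfl⟩
  rw [← hcO, Walk.mem_edges_toSubgraph, Walk.edges_mapLe_eq_edges] at he
  simpa using c.edges_subset_edgeSet he

theorem even_length_iff_of_notMem_edges (hO : ∀ C : G.Subgraph, IsOddCycle C → C = O)
    {e : Sym2 V} (he : e ∈ O.edgeSet) {s t : V} {p q : G.Walk s t} (hp : e ∉ p.edges)
    (hq : e ∉ q.edges) : Even p.length ↔ Even q.length := by
  let c : (G.deleteEdges {e}).Coloring Bool :=
    (two_colorable_deleteEdges hO he).toColoring (by simp)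
  have hp' := c.even_length_iff_congr (p.toDeleteEdge e hp)
  have hq' := c.even_length_iff_congr (q.toDeleteEdge e hq)
  rw [Walk.length_transfer] at hp' hq'
  exact hp'.trans hq'.symm

/- A walk between distinct vertices of `O` has the parity of both arcs of `O` it can be closed up
with, but these two parities differ. -/
theorem eq_of_walk_avoiding_edges (hodd : IsOddCycle O)
    (hO : ∀ C : G.Subgraph, IsOddCycle C → C = O) {s t : V} (hs : s ∈ O.verts)
    (ht : t ∈ O.verts) (w : G.Walk s t) (hw : ∀ e ∈ w.edges, e ∉ O.edgeSet) : s = t := by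
  classical
  obtain ⟨v, c, hc, hcodd, rfl⟩ := hodd
  rw [Walk.mem_verts_toSubgraph] at hs
  rw [← Walk.toSubgraph_rotate c hs, Walk.mem_verts_toSubgraph] at ht
  let a := (c.rotate s hs).takeUntil t ht
  let b := (c.rotate s hs).dropUntil t ht
  by_contra hst
  have hspec : a.append b = c.rotate s hs := Walk.take_spec _ ht
  have hmem : ∀ e, e ∈ c.toSubgraph.edgeSet ↔ e ∈ a.edges ∨ e ∈ b.edges := by
    intro e
    rw [← Walk.toSubgraph_rotate c hs, Walk.mem_edges_toSubgraph, ← hspec, Walk.edges_append,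
      List.mem_append]
  have hdisj : ∀ e ∈ a.edges, e ∉ b.edges := by
    have hnodup := (hc.rotate hs).isTrail.edges_nodup
    rw [← hspec, Walk.edges_append] at hnodup
    exact fun e ha hb => (List.nodup_append.1 hnodup).2.2 e ha e hb rfl
  have hlength : Odd (a.length + b.length) := by
    rwa [← Walk.length_append, hspec, Walk.length_rotate]
  have hx := Walk.mk_start_snd_mem_edges (Walk.not_nil_of_ne hst : ¬ a.Nil)
  have hy := Walk.mk_start_snd_mem_edges (Walk.not_nil_of_ne (Ne.symm hst) : ¬ b.Nil)
  have hwa : Even w.length ↔ Even a.length :=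
    even_length_iff_of_notMem_edges hO ((hmem _).2 (.inr hy))
      (fun h => hw _ h ((hmem _).2 (.inr hy))) (fun h => hdisj _ h hy)
  have hwb : Even w.length ↔ Even b.reverse.length :=
    even_length_iff_of_notMem_edges hO ((hmem _).2 (.inl hx))
      (fun h => hw _ h ((hmem _).2 (.inl hx))) (by simpa using hdisj _ hx)
  rw [Walk.length_reverse] at hwb
  grind

theorem exists_coloring_deleteEdges_eq_false (hodd : IsOddCycle O)
    (hO : ∀ C : G.Subgraph, IsOddCycle C → C = O) :
    ∃ c : (G.deleteEdges O.edgeSet).Coloring Bool, ∀ v ∈ O.verts, c v = false := by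
  obtain ⟨e, he⟩ : O.edgeSet.Nonempty := by
    obtain ⟨v, c, hc, -, rfl⟩ := hodd
    exact ⟨_, (Walk.mem_edges_toSubgraph c).2 (Walk.mk_start_snd_mem_edges hc.not_nil)⟩
  refine exists_coloring_eq_false ((two_colorable_deleteEdges hO he).mono_left ?_) ?_
  · exact deleteEdges_anti (Set.singleton_subset_iff.2 he)
  · rintro s hs t ht ⟨w⟩
    refine eq_of_walk_avoiding_edges hodd hO hs ht (w.mapLe (deleteEdges_le _)) fun e hew => ?_
    rw [Walk.edges_mapLe_eq_edges] at hew
    exact ((edgeSet_deleteEdges _ ▸ w.edges_subset_edgeSet hew :)).2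

end AlmostBipartite

section MatchingMap

variable {V : Type*} {G : SimpleGraph V} {σ τ : V → V}

/-- A matching of `G`, encoded as the involution that exchanges the ends of every matching edge
and fixes the unsaturated vertices. -/
structure IsMatchingMap (G : SimpleGraph V) (σ : V → V) : Prop where
  involutive : Involutive σ
  adj : ∀ v, σ v ≠ v → G.Adj v (σ v)

/-- A matching map with the least number of fixed points; it encodes a maximum matching. -/
structure IsMaximumMatchingMap (G : SimpleGraph V) (σ : V → V) : Prop
    extends IsMatchingMap G σ where
  ncard_fixedPoints_le : ∀ τ, IsMatchingMap G τ → (fixedPoints σ).ncard ≤ (fixedPoints τ).ncard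

/-- The matching encoded by a matching map, as a subgraph. -/
def IsMatchingMap.toSubgraph (hσ : IsMatchingMap G σ) : G.Subgraph where
  verts := (fixedPoints σ)ᶜ
  Adj u v := σ u = v ∧ u ≠ v
  adj_sub := by rintro u v ⟨rfl, hne⟩; exact hσ.adj u hne.symm
  edge_vert := by rintro u v ⟨rfl, hne⟩; exact hne.symm
  symm := ⟨by rintro u v ⟨rfl, hne⟩; exact ⟨hσ.involutive u, hne.symm⟩⟩

theorem IsMatchingMap.isMatching_toSubgraph (hσ : IsMatchingMap G σ) :
    hσ.toSubgraph.IsMatching :=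
  fun v hv => ⟨σ v, ⟨rfl, Ne.symm hv⟩, fun _ hw => hw.1.symm⟩

theorem exists_toSubgraph_eq {M : G.Subgraph} (hM : M.IsMatching) :
    ∃ (σ : V → V) (hσ : IsMatchingMap G σ), hσ.toSubgraph = M := by
  have hex : ∀ v, ∃ w, (v ∈ M.verts → M.Adj v w) ∧ (v ∉ M.verts → w = v) := by
    intro v
    by_cases hv : v ∈ M.verts
    · obtain ⟨w, hw, -⟩ := hM hv
      exact ⟨w, fun _ => hw, fun h => absurd hv h⟩
    · exact ⟨v, fun h => absurd h hv, fun _ => rfl⟩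
  choose σ hmem hnotMem using hex
  have hverts : ∀ v, v ∈ M.verts ↔ σ v ≠ v := fun v =>
    ⟨fun hv => (hmem v hv).adj_sub.ne', fun hne => by_contra fun hv => hne (hnotMem v hv)⟩
  have hadj : ∀ u v, M.Adj u v ↔ σ u = v ∧ u ≠ v := by
    refine fun u v => ⟨fun h => ⟨hM.eq_of_adj_left (hmem u (M.edge_vert h)) h, h.ne⟩, ?_⟩
    rintro ⟨rfl, hne⟩
    exact hmem u ((hverts u).2 hne.symm)
  refine ⟨σ, ⟨fun v => ?_, fun v hv => M.adj_sub (hmem v ((hverts v).2 hv))⟩, ?_⟩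
  · by_cases hv : σ v = v
    · rw [hv, hv]
    · exact ((hadj _ _).1 (hmem v ((hverts v).2 hv)).symm).1
  · ext u v
    · exact (hverts u).symm
    · exact (hadj u v).symm

theorem two_mul_ncard_image_mk [Finite V] (hσ : Involutive σ) {W : Set V}
    (hmaps : Set.MapsTo σ W W) (hne : ∀ v ∈ W, σ v ≠ v) :
    2 * ((fun v => s(v, σ v)) '' W).ncard = W.ncard := by
  classical
  have := Fintype.ofFinite V
  rw [Set.ncard_eq_toFinset_card' W, Set.ncard_eq_toFinset_card', Set.toFinset_image,
    Finset.card_eq_sum_card_image (fun v => s(v, σ v)) W.toFinset, mul_comm]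
  refine (Finset.sum_const_nat fun e he => ?_).symm
  obtain ⟨v, hv, rfl⟩ := Finset.mem_image.1 he
  rw [Set.mem_toFinset] at hv
  have hfiber : {a ∈ W.toFinset | s(a, σ a) = s(v, σ v)} = {v, σ v} := by
    ext a
    simp only [Finset.mem_filter, Set.mem_toFinset, Finset.mem_insert, Finset.mem_singleton,
      Sym2.eq_iff]
    constructor
    · rintro ⟨-, ⟨h, -⟩ | ⟨h, -⟩⟩
      exacts [.inl h, .inr h]
    · rintro (rfl | rfl)
      exacts [⟨hv, .inl ⟨rfl, rfl⟩⟩, ⟨hmaps hv, .inr ⟨rfl, hσ v⟩⟩]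
  rw [hfiber, Finset.card_pair (hne v hv).symm]

theorem IsMatchingMap.image_mk_eq_inter_edgeSet (hσ : IsMatchingMap G σ) (E : Set (Sym2 V)) :
    (fun v => s(v, σ v)) '' {v | σ v ≠ v ∧ s(v, σ v) ∈ E} = E ∩ hσ.toSubgraph.edgeSet := by
  ext e
  constructor
  · rintro ⟨v, ⟨hv, hvE⟩, rfl⟩
    exact ⟨hvE, rfl, hv.symm⟩
  · induction e with
    | h x y =>
      rintro ⟨hE, hadj⟩
      obtain ⟨rfl, hne⟩ := Subgraph.mem_edgeSet.1 hadj
      exact ⟨x, ⟨hne.symm, hE⟩, rfl⟩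

theorem IsMatchingMap.two_mul_ncard_inter_edgeSet [Finite V] (hσ : IsMatchingMap G σ)
    (E : Set (Sym2 V)) :
    2 * (E ∩ hσ.toSubgraph.edgeSet).ncard = {v | σ v ≠ v ∧ s(v, σ v) ∈ E}.ncard := by
  rw [← hσ.image_mk_eq_inter_edgeSet, two_mul_ncard_image_mk hσ.involutive]
  · rintro v ⟨hv, hvE⟩
    refine ⟨?_, ?_⟩
    · rw [hσ.involutive v]; exact hv.symm
    · rwa [hσ.involutive v, Sym2.eq_swap]
  · exact fun v hv => hv.1

theorem IsMatchingMap.two_mul_ncard_edgeSet_add_ncard_fixedPoints [Finite V]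
    (hσ : IsMatchingMap G σ) :
    2 * hσ.toSubgraph.edgeSet.ncard + (fixedPoints σ).ncard = Nat.card V := by
  have h := hσ.two_mul_ncard_inter_edgeSet Set.univ
  simp only [Set.univ_inter, Set.mem_univ, and_true] at h
  rw [h, add_comm]
  exact Set.ncard_add_ncard_compl (fixedPoints σ)

theorem IsMatchingMap.isMaximumMatching_toSubgraph_iff [Finite V] (hσ : IsMatchingMap G σ) :
    IsMaximumMatching hσ.toSubgraph ↔ IsMaximumMatchingMap G σ := by
  have hcard := hσ.two_mul_ncard_edgeSet_add_ncard_fixedPoints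
  constructor
  · refine fun h => ⟨hσ, fun τ hτ => ?_⟩
    have := h.2 _ hτ.isMatching_toSubgraph
    have := hτ.two_mul_ncard_edgeSet_add_ncard_fixedPoints
    lia
  · refine fun h => ⟨hσ.isMatching_toSubgraph, fun N hN => ?_⟩
    obtain ⟨τ, hτ, rfl⟩ := exists_toSubgraph_eq hN
    have := h.ncard_fixedPoints_le τ hτ
    have := hτ.two_mul_ncard_edgeSet_add_ncard_fixedPoints
    lia

theorem IsMaximumMatchingMap.mem_geD [Finite V] (hσ : IsMaximumMatchingMap G σ) {v : V}
    (hv : σ v = v) : v ∈ geD G :=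
  ⟨_, hσ.isMaximumMatching_toSubgraph_iff.2 hσ, fun h => h hv⟩

theorem exists_isMaximumMatchingMap_toSubgraph_eq [Finite V] {M : G.Subgraph}
    (hM : IsMaximumMatching M) :
    ∃ (σ : V → V) (hσ : IsMaximumMatchingMap G σ), hσ.toSubgraph = M := by
  obtain ⟨σ, hσ, rfl⟩ := exists_toSubgraph_eq hM.1
  exact ⟨σ, hσ.isMaximumMatching_toSubgraph_iff.1 hM, rfl⟩

end MatchingMap

section Gluing

variable {V : Type*} {G : SimpleGraph V} {σ τ ρ : V → V} {S T : Set V}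

theorem IsMatchingMap.id (G : SimpleGraph V) : IsMatchingMap G id :=
  ⟨fun _ => rfl, fun _ h => absurd rfl h⟩

theorem IsMatchingMap.swap [DecidableEq V] {u v : V} (h : G.Adj u v) :
    IsMatchingMap G (Equiv.swap u v) := by
  refine ⟨fun w => Equiv.swap_apply_self u v w, fun w hw => ?_⟩
  obtain ⟨-, rfl | rfl⟩ := Equiv.swap_apply_ne_self_iff.1 hw
  · simpa using h
  · simpa using h.symm

theorem IsMatchingMap.mapsTo_of_fixedPoints_eq (hσ : IsMatchingMap G σ)
    (hT : fixedPoints σ = Tᶜ) (hTS : T ⊆ S) : Set.MapsTo σ S S := by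
  intro v hv
  by_cases hfix : σ v = v
  · rwa [hfix]
  · by_contra hnot
    have : σ v ∈ fixedPoints σ := hT ▸ fun h => hnot (hTS h)
    exact hfix (hσ.involutive.injective this)

theorem IsMatchingMap.mapsTo_compl (hσ : IsMatchingMap G σ) (hS : Set.MapsTo σ S S) :
    Set.MapsTo σ Sᶜ Sᶜ :=
  fun v hv h => hv (hσ.involutive v ▸ hS h)

theorem IsMatchingMap.piecewise [∀ v, Decidable (v ∈ S)] (hσ : IsMatchingMap G σ)
    (hτ : IsMatchingMap G τ) (hσS : Set.MapsTo σ S S) (hτS : Set.MapsTo τ S S) :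
    IsMatchingMap G (S.piecewise σ τ) := by
  constructor <;> intro v <;> by_cases hv : v ∈ S
  · rw [Set.piecewise_eq_of_mem S σ τ hv, Set.piecewise_eq_of_mem S σ τ (hσS hv), hσ.involutive]
  · rw [Set.piecewise_eq_of_notMem S σ τ hv,
      Set.piecewise_eq_of_notMem S σ τ (hτ.mapsTo_compl hτS hv), hτ.involutive]
  · simpa only [Set.piecewise_eq_of_mem S σ τ hv] using hσ.adj v
  · simpa only [Set.piecewise_eq_of_notMem S σ τ hv] using hτ.adj v

theorem ncard_fixedPoints_piecewise [Finite V] [∀ v, Decidable (v ∈ S)] (σ τ : V → V) :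
    (fixedPoints (S.piecewise σ τ)).ncard =
      (fixedPoints σ ∩ S).ncard + (fixedPoints τ \ S).ncard := by
  have heq : fixedPoints (S.piecewise σ τ) = (fixedPoints σ ∩ S) ∪ (fixedPoints τ \ S) := by
    ext v
    by_cases hv : v ∈ S <;> simp [mem_fixedPoints, IsFixedPt, hv]
  rw [heq, Set.ncard_union_eq (Set.disjoint_sdiff_right.mono_left Set.inter_subset_right)]

theorem IsMaximumMatchingMap.ncard_fixedPoints_inter_le [Finite V]
    (hσ : IsMaximumMatchingMap G σ) (hτ : IsMatchingMap G τ) (hσS : Set.MapsTo σ S S)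
    (hτS : Set.MapsTo τ S S) : (fixedPoints σ ∩ S).ncard ≤ (fixedPoints τ ∩ S).ncard := by
  classical
  have hle := hσ.ncard_fixedPoints_le _ (hτ.piecewise hσ.toIsMatchingMap hτS hσS)
  have hsplit := Set.ncard_inter_add_ncard_sdiff_eq_ncard (fixedPoints σ) S
  rw [ncard_fixedPoints_piecewise] at hle
  lia

theorem IsMaximumMatchingMap.piecewise_of_ncard_le [Finite V] [∀ v, Decidable (v ∈ S)]
    (hτ : IsMaximumMatchingMap G τ) (hσ : IsMatchingMap G σ) (hσS : Set.MapsTo σ S S)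
    (hτS : Set.MapsTo τ S S) (hle : (fixedPoints σ ∩ S).ncard ≤ (fixedPoints τ ∩ S).ncard) :
    IsMaximumMatchingMap G (S.piecewise σ τ) := by
  refine ⟨hσ.piecewise hτ.toIsMatchingMap hσS hτS, fun ρ hρ => ?_⟩
  have hmax := hτ.ncard_fixedPoints_le ρ hρ
  have hsplit := Set.ncard_inter_add_ncard_sdiff_eq_ncard (fixedPoints τ) S
  rw [ncard_fixedPoints_piecewise]
  lia

theorem IsMaximumMatchingMap.piecewise [Finite V] [∀ v, Decidable (v ∈ S)]
    (hσ : IsMaximumMatchingMap G σ) (hτ : IsMaximumMatchingMap G τ) (hσS : Set.MapsTo σ S S)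
    (hτS : Set.MapsTo τ S S) : IsMaximumMatchingMap G (S.piecewise σ τ) :=
  hτ.piecewise_of_ncard_le hσ.toIsMatchingMap hσS hτS
    (hσ.ncard_fixedPoints_inter_le hτ.toIsMatchingMap hσS hτS)

theorem IsMaximumMatchingMap.piecewise_of_fixedPoints_eq [Finite V] [∀ v, Decidable (v ∈ S)]
    (hσ : IsMaximumMatchingMap G σ) (hσS : Set.MapsTo σ S S) {r x : V} (hrS : r ∈ S)
    (hr : σ r = r) (hρ : IsMatchingMap G ρ) (hfix : fixedPoints ρ = (S \ {x})ᶜ) :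
    IsMaximumMatchingMap G (S.piecewise ρ σ) := by
  have hle : (fixedPoints ρ ∩ S).ncard ≤ 1 := by
    refine (Set.ncard_le_ncard fun v hv => ?_).trans (Set.ncard_singleton x).le
    by_contra hvx
    exact (hfix ▸ hv.1 : v ∈ (S \ {x})ᶜ) ⟨hv.2, hvx⟩
  refine hσ.piecewise_of_ncard_le hρ (hρ.mapsTo_of_fixedPoints_eq hfix Set.sdiff_subset) hσS
    (hle.trans ?_)
  exact (Set.ncard_pos (Set.toFinite _)).2 ⟨r, hr, hrS⟩

theorem IsMaximumMatchingMap.not_adj [Finite V] (hσ : IsMaximumMatchingMap G σ) {x y : V}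
    (hx : σ x = x) (hy : σ y = y) : ¬ G.Adj x y := by
  classical
  intro hxy
  have hle := hσ.ncard_fixedPoints_inter_le (S := {x, y}) (IsMatchingMap.swap hxy)
    (by rintro v (rfl | rfl) <;> simp [hx, hy]) (by rintro v (rfl | rfl) <;> simp)
  have hempty : fixedPoints (Equiv.swap x y) ∩ {x, y} = ∅ := by
    refine Set.eq_empty_of_forall_notMem ?_
    rintro v ⟨hv, rfl | rfl⟩
    · exact hxy.ne' ((Equiv.swap_apply_left _ _).symm.trans hv)
    · exact hxy.ne ((Equiv.swap_apply_right _ _).symm.trans hv)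
  rw [hempty, Set.ncard_empty, Nat.le_zero, Set.ncard_eq_zero] at hle
  exact hle.le ⟨hx, Set.mem_insert _ _⟩

end Gluing

section OddCycleMatchings

variable {V : Type*} {G : SimpleGraph V}

theorem exists_isMatchingMap_of_isPath : ∀ {u v : V} (p : G.Walk u v), p.IsPath → Even p.length →
    ∃ ρ, IsMatchingMap G ρ ∧ fixedPoints ρ = ({w | w ∈ p.support} \ {u})ᶜ
  | _, _, .nil, _, _ => ⟨id, IsMatchingMap.id G, by ext; simp⟩
  | _, _, .cons _ .nil, _, heven => by simp at heven
  | u, _, .cons (v := x) hux (.cons (v := y) hxy q), hp, heven => by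
    classical
    simp only [Walk.cons_isPath_iff, Walk.support_cons, List.mem_cons, not_or] at hp
    obtain ⟨⟨hq, hxq⟩, -, huq⟩ := hp
    obtain ⟨ρ, hρ, hfix⟩ := exists_isMatchingMap_of_isPath q hq (by
      simpa only [Walk.length_cons, Nat.even_add_one, not_not] using heven)
    have hρ_eq : ∀ w, ρ w = w ↔ (w ∈ q.support → w = y) := fun w => by
      simpa [IsFixedPt] using Set.ext_iff.1 hfix w
    have hswap : IsMatchingMap G (Equiv.swap x y) := IsMatchingMap.swap hxy
    refine ⟨Set.piecewise {x, y} (Equiv.swap x y) ρ, hswap.piecewise hρ ?_ ?_, ?_⟩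
    · rintro w (rfl | rfl) <;> simp
    · rintro w (rfl | rfl)
      · simp [(hρ_eq w).2 (fun h => absurd h hxq)]
      · simp [(hρ_eq w).2 (fun _ => rfl)]
    · ext w
      have hux' := hux.ne
      have hxy' := hxy.ne
      have hyq := q.start_mem_support
      simp only [mem_fixedPoints, IsFixedPt, Set.piecewise, Equiv.swap_apply_def, Walk.support_cons]
      grind

theorem exists_isMatchingMap_of_isCycle {b o : V} {c : G.Walk b b} (hc : c.IsCycle)
    (hodd : Odd c.length) (ho : o ∈ c.support) :
    ∃ ρ, IsMatchingMap G ρ ∧ fixedPoints ρ = ({v | v ∈ c.support} \ {o})ᶜ := by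
  classical
  let d := c.rotate o ho
  have hd : d.IsCycle := hc.rotate ho
  have hlength : d.tail.reverse.length + 1 = c.length := by
    rw [Walk.length_reverse, Walk.length_tail_add_one hd.not_nil, Walk.length_rotate]
  obtain ⟨ρ, hρ, hfix⟩ := exists_isMatchingMap_of_isPath d.tail.reverse hd.isPath_tail.reverse
    (by grind)
  have hsupport : ∀ v, v ∈ d.tail.reverse.support ↔ v ∈ c.support := fun v => by
    rw [Walk.support_reverse, List.mem_reverse, ← Walk.mem_verts_toSubgraph c,
      ← Walk.toSubgraph_rotate c ho, Walk.mem_verts_toSubgraph,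
      ← Walk.cons_support_tail hd.not_nil, List.mem_cons]
    exact ⟨.inr, fun h => h.elim (fun h => h ▸ d.tail.end_mem_support) id⟩
  exact ⟨ρ, hρ, by simpa only [hsupport] using hfix⟩

theorem ncard_support_of_isCycle {b : V} {c : G.Walk b b} (hc : c.IsCycle) :
    {v | v ∈ c.support}.ncard = c.length := by
  classical
  have htail : {v | v ∈ c.support} = (c.support.tail.toFinset : Set V) := by
    ext v
    rw [Finset.mem_coe, List.mem_toFinset, Set.mem_ofPred_eq, Walk.mem_support_iff]
    exact or_iff_right_of_imp fun h => h ▸ Walk.end_mem_tail_support hc.not_nil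
  rw [htail, Set.ncard_coe_finset, List.toFinset_card_of_nodup hc.support_nodup]
  simp

end OddCycleMatchings

section Flowers

variable {V : Type*} {G : SimpleGraph V} {σ : V → V} {b r : V} {c : G.Walk b b}
  {p : G.Walk b r}

theorem IsBlossom.setOf_mem_edges_eq [Finite V] {hσ : IsMatchingMap G σ}
    (hc : IsBlossom hσ.toSubgraph c) :
    {v | σ v ≠ v ∧ s(v, σ v) ∈ c.edges} = {v | v ∈ c.support} \ {b} := by
  refine Set.eq_of_subset_of_ncard_le ?_ ?_
  · rintro v ⟨hv, hve⟩
    refine ⟨c.fst_mem_support_of_mem_edges hve, ?_⟩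
    rintro rfl
    exact hc.base _ hve (Sym2.mem_mk_left _ _) (Subgraph.mem_edgeSet.2 ⟨rfl, hv.symm⟩)
  · have hb : b ∈ {v | v ∈ c.support} := c.start_mem_support
    have hlength : c.length = 2 * ({e | e ∈ c.edges} ∩ hσ.toSubgraph.edgeSet).ncard + 1 :=
      hc.length_eq
    rw [Set.ncard_sdiff_singleton_of_mem hb, ncard_support_of_isCycle hc.isCycle, hlength,
      hσ.two_mul_ncard_inter_edgeSet]
    rfl

theorem IsBlossom.mapsTo [Finite V] {hσ : IsMatchingMap G σ} (hc : IsBlossom hσ.toSubgraph c) :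
    Set.MapsTo σ ({v | v ∈ c.support} \ {b}) ({v | v ∈ c.support} \ {b}) := by
  rw [← hc.setOf_mem_edges_eq]
  rintro v ⟨hv, hve⟩
  refine ⟨?_, ?_⟩
  · rw [hσ.involutive v]
    exact hv.symm
  · rwa [hσ.involutive v, Sym2.eq_swap]

theorem IsBlossom.apply_ne [Finite V] {hσ : IsMatchingMap G σ}
    (hc : IsBlossom hσ.toSubgraph c) {v : V} (hv : v ∈ c.support) (hvb : v ≠ b) : σ v ≠ v := by
  have : v ∈ {v | σ v ≠ v ∧ s(v, σ v) ∈ c.edges} := hc.setOf_mem_edges_eq ▸ ⟨hv, hvb⟩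
  exact this.1

theorem IsAlternatingWalk.adj_getVert_iff {M : G.Subgraph} (hp : IsAlternatingWalk M p)
    (hr : r ∉ M.verts) {i : ℕ} (hi : i < p.length) :
    M.Adj (p.getVert i) (p.getVert (i + 1)) ↔ Even (p.length - i) := by
  obtain ⟨k, hk⟩ := Nat.exists_eq_add_of_lt hi
  induction k generalizing i with
  | zero =>
    have hend : p.getVert (i + 1) = r := p.getVert_of_length_le hk.le
    have hnot : ¬ M.Adj (p.getVert i) (p.getVert (i + 1)) := fun h =>
      hr (hend ▸ M.edge_vert h.symm)
    grind
  | succ k ih =>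
    have hnext := ih (i := i + 1) (by lia) (by lia)
    have halt := hp.getElem i (by rw [Walk.length_edges]; lia)
    rw [Walk.getElem_edges, Walk.getElem_edges, Subgraph.mem_edgeSet, Subgraph.mem_edgeSet,
      hnext] at halt
    grind

theorem IsFlower.notMem_edges {M : G.Subgraph} (hf : IsFlower M c p) {e : Sym2 V}
    (he : e ∈ p.edges) : e ∉ c.edges := by
  induction e with
  | h x y =>
    intro hec
    have hx := hf.inter x (c.fst_mem_support_of_mem_edges hec) (p.fst_mem_support_of_mem_edges he)
    have hy := hf.inter y (c.snd_mem_support_of_mem_edges hec) (p.snd_mem_support_of_mem_edges he)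
    exact (p.adj_of_mem_edges he).ne (hx.trans hy.symm)

theorem IsFlower.mapsTo_support_drop {hσ : IsMatchingMap G σ} (hf : IsFlower hσ.toSubgraph c p)
    {j : ℕ} (hj : Even j) :
    Set.MapsTo σ {v | v ∈ (p.drop j).support} {v | v ∈ (p.drop j).support} := by
  have hnext : ∀ i < p.length, Even i → σ (p.getVert i) = p.getVert (i + 1) := fun i hi heven =>
    ((hf.alternating.adj_getVert_iff hf.root hi).2 (hf.even_length.tsub heven)).1
  intro v hv
  obtain ⟨i, rfl, hi⟩ := Walk.mem_support_iff_exists_getVert.1 hv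
  rw [Walk.drop_length] at hi
  have hmem : ∀ k, j ≤ k → p.getVert k ∈ (p.drop j).support := fun k hk => by
    rw [← Nat.add_sub_of_le hk, ← Walk.drop_getVert]
    exact Walk.getVert_mem_support _ _
  change σ ((p.drop j).getVert i) ∈ (p.drop j).support
  rw [Walk.drop_getVert]
  rcases Nat.even_or_odd' i with ⟨m, rfl | rfl⟩
  · rcases (le_or_gt p.length (j + 2 * m)) with hle | hlt
    · have hr : σ r = r := by_contra fun h => hf.root h
      rw [p.getVert_of_length_le hle, hr]
      exact (p.drop j).end_mem_support
    · rw [hnext _ hlt (hj.add (even_two_mul m))]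
      exact hmem _ (by lia)
  · rw [← add_assoc, ← hnext (j + 2 * m) (by lia) (hj.add (even_two_mul m)), hσ.involutive]
    exact hmem _ (by lia)

theorem IsFlower.exists_isMaximumMatchingMap_getVert [Finite V]
    (hσ : IsMaximumMatchingMap G σ) (hf : IsFlower hσ.toSubgraph c p) {j : ℕ} (hj : Even j) :
    ∃ τ, IsMaximumMatchingMap G τ ∧ τ (p.getVert j) = p.getVert j ∧
      ∀ v ∈ c.support, v ≠ b → τ v = σ v := by
  classical
  let S : Set V := {v | v ∈ (p.drop j).support}
  obtain ⟨ρ, hρ, hfix⟩ := exists_isMatchingMap_of_isPath (p.drop j) (hf.isPath.drop j)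
    (by rw [Walk.drop_length]; exact hf.even_length.tsub hj)
  have hr : σ r = r := by_contra fun h => hf.root h
  refine ⟨S.piecewise ρ σ, hσ.piecewise_of_fixedPoints_eq (hf.mapsTo_support_drop hj)
    (p.drop j).end_mem_support hr hρ hfix, ?_, fun v hv hvb => ?_⟩
  · rw [Set.piecewise_eq_of_mem S ρ σ (p.drop j).start_mem_support]
    exact hfix.ge fun h => h.2 rfl
  · refine Set.piecewise_eq_of_notMem S ρ σ fun h => hvb (hf.inter v hv ?_)
    exact (p.isSubwalk_drop j).support_subset h

end Flowers

section Alternation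

variable {V : Type*} {G : SimpleGraph V} {σ τ : V → V} {κ : V → Bool} {x y : V}

theorem exists_mapsTo_of_crossing (hσ : Involutive σ) (hτ : Involutive τ)
    (hκ : ∀ v, σ v = τ v ∨
      (σ v ≠ v → κ v ≠ κ (σ v)) ∧ (τ v ≠ v → κ v ≠ κ (τ v)))
    (hκx : κ x = false) (hx : σ x = x) (hκy : κ y = true) (hy : τ y = y) :
    ∃ S : Set V, Set.MapsTo σ S S ∧ Set.MapsTo τ S S ∧ x ∈ S ∧ y ∉ S := by
  let next (v : V) : V := bif κ v then σ v else τ v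
  let prev (v : V) : V := bif κ v then τ v else σ v
  have hprev : ∀ u v, next u = v → v ≠ u → prev v = u := by
    intro u v huv hne
    have hcross := hκ v
    cases hu : κ u <;> cases hv : κ v <;> simp only [next, prev, hu, hv, cond] at huv ⊢
    · have := huv ▸ hτ u
      grind
    · exact huv ▸ hτ u
    · exact huv ▸ hσ u
    · have := huv ▸ hσ u
      grind
  let S : Set V := {v | ∃ n, next^[n] x = v}
  have hnext : ∀ v ∈ S, next v ∈ S := by
    rintro _ ⟨n, rfl⟩
    exact ⟨n + 1, iterate_succ_apply' next n x⟩
  have hclosed : ∀ v ∈ S, σ v ∈ S ∧ τ v ∈ S ∧ v ≠ y := by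
    rintro _ ⟨n, rfl⟩
    induction n with
    | zero =>
      have := hnext x ⟨0, rfl⟩
      simp only [next, hκx, cond_false] at this
      exact ⟨⟨0, hx.symm⟩, this, fun h => by simp_all⟩
    | succ n ih =>
      rw [iterate_succ_apply']
      have hu : next^[n] x ∈ S := ⟨n, rfl⟩
      generalize next^[n] x = u at *
      rcases eq_or_ne (next u) u with heq | hne
      · rwa [heq]
      · have hnv := hnext _ (hnext u hu)
        have hpv : prev (next u) ∈ S := (hprev u _ rfl hne).symm ▸ hu
        refine ⟨?_, ?_, fun h => ih.2.2 ?_⟩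
        · cases hv : κ (next u) <;> grind
        · cases hv : κ (next u) <;> grind
        · rw [← hprev u y h ih.2.2.symm]
          simp [prev, hκy, hy]
  exact ⟨S, fun v hv => (hclosed v hv).1, fun v hv => (hclosed v hv).2.1, ⟨0, rfl⟩,
    fun h => (hclosed y h).2.2 rfl⟩

theorem IsMaximumMatchingMap.not_adj_of_crossing [Finite V] (hσ : IsMaximumMatchingMap G σ)
    (hτ : IsMaximumMatchingMap G τ)
    (hκ : ∀ v, σ v = τ v ∨
      (σ v ≠ v → κ v ≠ κ (σ v)) ∧ (τ v ≠ v → κ v ≠ κ (τ v)))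
    (hκx : κ x = false) (hx : σ x = x) (hκy : κ y = true) (hy : τ y = y) : ¬ G.Adj x y := by
  classical
  obtain ⟨S, hσS, hτS, hxS, hyS⟩ :=
    exists_mapsTo_of_crossing hσ.involutive hτ.involutive hκ hκx hx hκy hy
  refine (hσ.piecewise hτ hσS hτS).not_adj ?_ ?_
  · rwa [Set.piecewise_eq_of_mem S σ τ hxS]
  · rwa [Set.piecewise_eq_of_notMem S σ τ hyS]

end Alternation

section ReachSet

variable {V : Type*} {G : SimpleGraph V} {σ τ : V → V} {b r : V} {c : G.Walk b b}
  {p : G.Walk b r}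

theorem IsFlower.exists_isMaximumMatchingMap_base [Finite V] (hσ : IsMaximumMatchingMap G σ)
    (hf : IsFlower hσ.toSubgraph c p) :
    ∃ τ, IsMaximumMatchingMap G τ ∧ τ b = b ∧
      Set.MapsTo τ c.toSubgraph.verts c.toSubgraph.verts := by
  obtain ⟨τ, hτ, hτb, heq⟩ := hf.exists_isMaximumMatchingMap_getVert hσ Even.zero
  rw [Walk.getVert_zero] at hτb
  refine ⟨τ, hτ, hτb, fun v hv => ?_⟩
  rw [Walk.mem_verts_toSubgraph] at hv ⊢
  by_cases hvb : v = b
  · subst hvb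
    rwa [hτb]
  · rw [heq v hv hvb]
    exact (hf.blossom.mapsTo ⟨hv, hvb⟩).1

theorem IsFlower.mem_geD_of_mem_support [Finite V] (hσ : IsMaximumMatchingMap G σ)
    (hf : IsFlower hσ.toSubgraph c p) {v : V} (hv : v ∈ c.support) : v ∈ geD G := by
  classical
  obtain ⟨τ, hτ, hτb, hτc⟩ := hf.exists_isMaximumMatchingMap_base hσ
  rw [Walk.verts_toSubgraph] at hτc
  obtain ⟨ρ, hρ, hfix⟩ := exists_isMatchingMap_of_isCycle hf.blossom.isCycle
    ⟨_, hf.blossom.length_eq⟩ hv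
  refine (hτ.piecewise_of_fixedPoints_eq hτc c.start_mem_support hτb hρ hfix).mem_geD (v := v) ?_
  rw [Set.piecewise_eq_of_mem {v | v ∈ c.support} ρ τ hv]
  exact hfix.ge fun h => h.2 rfl

theorem IsMatchingMap.coloring_ne {O : G.Subgraph} (κ : (G.deleteEdges O.edgeSet).Coloring Bool)
    (hσ : IsMatchingMap G σ) (hσO : Set.MapsTo σ (O.verts \ {b}) (O.verts \ {b})) {v : V}
    (hv : v ∉ O.verts \ {b}) (hne : σ v ≠ v) : κ v ≠ κ (σ v) := by
  have hσv : σ v ∉ O.verts \ {b} := hσ.mapsTo_compl hσO hv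
  refine κ.valid (deleteEdges_adj.2 ⟨hσ.adj v hne, fun h => hne ?_⟩)
  have hvb : v = b := by_contra fun hvb => hv ⟨O.edge_vert h, hvb⟩
  have hσvb : σ v = b := by_contra fun hvb => hσv ⟨O.edge_vert h.symm, hvb⟩
  exact hσvb.trans hvb.symm

theorem IsFlower.coloring_getVert_eq_false_iff {M : G.Subgraph} (hf : IsFlower M c p)
    {κ : (G.deleteEdges c.toSubgraph.edgeSet).Coloring Bool} (hκ : κ b = false) {j : ℕ}
    (hj : j ≤ p.length) : κ (p.getVert j) = false ↔ Even j := by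
  induction j with
  | zero => simpa using hκ
  | succ j ih =>
    have hadj := p.adj_getVert_succ hj
    have hmem : s(p.getVert j, p.getVert (j + 1)) ∈ p.edges := by
      rw [← Walk.getElem_edges (by simpa using hj)]
      exact List.getElem_mem _
    have hne := κ.valid (deleteEdges_adj.2 ⟨hadj, fun h =>
      hf.notMem_edges hmem ((Walk.mem_edges_toSubgraph c).1 h)⟩)
    grind

theorem mem_geD_of_coloring_eq_false [Finite V] {O : G.Subgraph} (hreach : reachSet O = Set.univ)
    (κ : (G.deleteEdges O.edgeSet).Coloring Bool) (hκO : ∀ v ∈ O.verts, κ v = false) {v : V}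
    (hv : κ v = false) : v ∈ geD G := by
  obtain ⟨M, hM, b, r, c, p, hf, rfl, hvc | hvp⟩ : v ∈ reachSet O := hreach ▸ Set.mem_univ v
  all_goals obtain ⟨σ, hσ, rfl⟩ := exists_isMaximumMatchingMap_toSubgraph_eq hM
  · exact hf.mem_geD_of_mem_support hσ hvc
  · obtain ⟨j, rfl, hj⟩ := Walk.mem_support_iff_exists_getVert.1 hvp
    have heven : Even j :=
      (hf.coloring_getVert_eq_false_iff (hκO b c.start_mem_verts_toSubgraph) hj).1 hv
    obtain ⟨τ, hτ, hτv, -⟩ := hf.exists_isMaximumMatchingMap_getVert hσ heven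
    exact hτ.mem_geD hτv

theorem IsBlossom.exists_isMaximumMatchingMap_eqOn [Finite V] {hσ : IsMatchingMap G σ}
    (hc : IsBlossom hσ.toSubgraph c) (hτ : IsMaximumMatchingMap G τ)
    (hτc : Set.MapsTo τ c.toSubgraph.verts c.toSubgraph.verts) {o : V}
    (ho : o ∈ c.toSubgraph.verts) (hτo : τ o = o) :
    ∃ τ', IsMaximumMatchingMap G τ' ∧ Set.EqOn τ' σ (c.toSubgraph.verts \ {b}) ∧
      Set.EqOn τ' τ c.toSubgraph.vertsᶜ := by
  classical
  rw [Walk.verts_toSubgraph] at *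
  let S : Set V := {v | v ∈ c.support}
  let ρ := (S \ {b}).piecewise σ id
  have hρ : IsMatchingMap G ρ := hσ.piecewise (IsMatchingMap.id G) hc.mapsTo fun _ => id
  have hfix : fixedPoints ρ = (S \ {b})ᶜ := by
    ext v
    by_cases hv : v ∈ S \ {b}
    · simpa [ρ, IsFixedPt, hv] using hc.apply_ne hv.1 hv.2
    · simp [ρ, IsFixedPt, hv]
  refine ⟨S.piecewise ρ τ, hτ.piecewise_of_fixedPoints_eq hτc ho hτo hρ hfix, fun v hv => ?_,
    Set.piecewise_eqOn_compl S ρ τ⟩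
  rw [Set.piecewise_eq_of_mem S ρ τ hv.1]
  exact Set.piecewise_eq_of_mem (S \ {b}) σ id hv

theorem apply_ne_of_coloring_eq_true [Finite V] {O : G.Subgraph} (hreach : reachSet O = Set.univ)
    (κ : (G.deleteEdges O.edgeSet).Coloring Bool) (hκO : ∀ v ∈ O.verts, κ v = false)
    (hτ : IsMaximumMatchingMap G τ) (hτO : Set.MapsTo τ O.verts O.verts) {o : V}
    (ho : o ∈ O.verts) (hτo : τ o = o) {y : V} (hy : κ y = true) : τ y ≠ y := by
  intro hτy
  have hyO : y ∉ O.verts := fun h => by simp [hκO y h] at hy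
  obtain ⟨M, hM, b, r, c, p, hf, rfl, hyc | hyp⟩ : y ∈ reachSet O := hreach ▸ Set.mem_univ y
  · exact hyO ((Walk.mem_verts_toSubgraph c).2 hyc)
  obtain ⟨σ, hσ, rfl⟩ := exists_isMaximumMatchingMap_toSubgraph_eq hM
  have hκp {j : ℕ} (hj : j ≤ p.length) :=
    hf.coloring_getVert_eq_false_iff (hκO b c.start_mem_verts_toSubgraph) hj
  obtain ⟨i, rfl, hi⟩ := Walk.mem_support_iff_exists_getVert.1 hyp
  obtain ⟨j, rfl⟩ : Odd i := by grind
  have hκx : κ (p.getVert (2 * j)) = false := (hκp (by lia)).2 (even_two_mul j)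
  obtain ⟨σ', hσ', hσ'x, hσ'σ⟩ := hf.exists_isMaximumMatchingMap_getVert hσ (even_two_mul j)
  obtain ⟨τ', hτ', hτ'σ, hτ'τ⟩ := hf.blossom.exists_isMaximumMatchingMap_eqOn hτ hτO ho hτo
  replace hσ'σ : Set.EqOn σ' σ (c.toSubgraph.verts \ {b}) := fun v hv =>
    hσ'σ v ((Walk.mem_verts_toSubgraph c).1 hv.1) hv.2
  have hσO : Set.MapsTo σ (c.toSubgraph.verts \ {b}) (c.toSubgraph.verts \ {b}) := by
    rw [Walk.verts_toSubgraph]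
    exact hf.blossom.mapsTo
  have hcross : ∀ v, σ' v = τ' v ∨
      (σ' v ≠ v → κ v ≠ κ (σ' v)) ∧ (τ' v ≠ v → κ v ≠ κ (τ' v)) := by
    intro v
    by_cases hv : v ∈ c.toSubgraph.verts \ {b}
    · exact .inl ((hσ'σ hv).trans (hτ'σ hv).symm)
    · exact .inr ⟨hσ'.coloring_ne κ (hσO.congr hσ'σ.symm) hv,
        hτ'.coloring_ne κ (hσO.congr hτ'σ.symm) hv⟩
  exact hσ'.not_adj_of_crossing hτ' hcross hκx hσ'x hy ((hτ'τ hyO).trans hτy)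
    (p.adj_getVert_succ (by lia))

theorem IsAlmostBipartite.exists_ncard_le_of_reachSet [Finite V] (hG : IsAlmostBipartite G)
    (hreach : ∀ C : G.Subgraph, IsOddCycle C → reachSet C = Set.univ) :
    ∃ I Y : Set V, geA G ⊆ Y ∧ Disjoint I Y ∧ (∀ u ∈ I, G.neighborSet u ⊆ Y) ∧
      Y.ncard ≤ I.ncard := by
  obtain ⟨O, hO, hunique⟩ := hG
  obtain ⟨κ, hκO⟩ := exists_coloring_deleteEdges_eq_false hO hunique
  obtain ⟨τ, hτ, b, hb, hτb, hτO⟩ :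
      ∃ τ, IsMaximumMatchingMap G τ ∧ ∃ b ∈ O.verts, τ b = b ∧ Set.MapsTo τ O.verts O.verts := by
    obtain ⟨v, -⟩ := id hO
    obtain ⟨M, hM, b, r, c, p, hf, rfl, -⟩ : v ∈ reachSet O := hreach O hO ▸ Set.mem_univ v
    obtain ⟨σ, hσ, rfl⟩ := exists_isMaximumMatchingMap_toSubgraph_eq hM
    obtain ⟨τ, hτ, hτb, hτO⟩ := hf.exists_isMaximumMatchingMap_base hσ
    exact ⟨τ, hτ, b, c.start_mem_verts_toSubgraph, hτb, hτO⟩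
  have hcross {u v : V} (huv : G.Adj u v) (hu : u ∉ O.verts) : κ u ≠ κ v :=
    κ.valid (deleteEdges_adj.2 ⟨huv, fun h => hu (O.edge_vert h)⟩)
  have hYO {y : V} (hy : κ y = true) : y ∉ O.verts := fun h => by simp [hκO y h] at hy
  refine ⟨{v | κ v = false} \ O.verts, {v | κ v = true}, fun v hv => ?_, ?_, ?_, ?_⟩
  · exact Bool.eq_true_of_not_eq_false fun h =>
      hv.1 (mem_geD_of_coloring_eq_false (hreach O hO) κ hκO h)
  · exact Set.disjoint_left.2 fun v hv hv' => by simp_all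
  · intro u hu v huv
    have := hcross huv hu.2
    grind
  · refine Set.ncard_le_ncard_of_injOn τ (fun y hy => ?_) hτ.involutive.injective.injOn
    have hne := apply_ne_of_coloring_eq_true (hreach O hO) κ hκO hτ hτO hb hτb hy
    have := hcross (hτ.adj y hne) (hYO hy)
    exact ⟨by grind, hτ.mapsTo_compl hτO (hYO hy)⟩

end ReachSet

section Weights

theorem eq_zero_of_mem_doublyStochastic {n R : Type*} [Fintype n] [DecidableEq n] [Ring R]
    [PartialOrder R] [IsOrderedRing R] {M : Matrix n n R} (hM : M ∈ doublyStochastic R n)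
    {s t : Finset n} (hcard : t.card ≤ s.card) (hzero : ∀ i ∈ s, ∀ j ∉ t, M i j = 0) {i j : n}
    (hi : i ∉ s) (hj : j ∈ t) : M i j = 0 := by
  have hnonneg (i j : n) : 0 ≤ M i j := nonneg_of_mem_doublyStochastic hM
  have hrows : ∑ i ∈ s, ∑ j ∈ t, M i j = s.card := by
    rw [← nsmul_one, ← Finset.sum_const]
    refine Finset.sum_congr rfl fun i hi => ?_
    rw [← sum_row_of_mem_doublyStochastic hM i]
    exact Finset.sum_subset t.subset_univ fun j _ hj => hzero i hi j hj
  have hcols : ∑ i, ∑ j ∈ t, M i j = t.card := by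
    refine Finset.sum_comm.trans ?_
    rw [← nsmul_one, ← Finset.sum_const]
    exact Finset.sum_congr rfl fun j _ => sum_col_of_mem_doublyStochastic hM j
  have hcompl : ∑ i ∈ sᶜ, ∑ j ∈ t, M i j ≤ 0 := by
    have hsplit := Finset.sum_add_sum_compl s fun i => ∑ j ∈ t, M i j
    rw [hrows, hcols] at hsplit
    refine le_of_add_le_add_left (a := (s.card : R)) ?_
    rw [hsplit, add_zero]
    exact Nat.mono_cast hcard
  have hrow : ∑ j ∈ t, M i j ≤ 0 :=
    (Finset.single_le_sum (fun i _ => Finset.sum_nonneg fun j _ => hnonneg i j)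
      (Finset.mem_compl.2 hi)).trans hcompl
  exact ((Finset.single_le_sum (fun j _ => hnonneg i j) hj).trans hrow).antisymm (hnonneg i j)

variable {V : Type*} {H : SimpleGraph V}

theorem adjMatrix_div_degree_mem_doublyStochastic [Fintype V] [DecidableEq V]
    [DecidableRel H.Adj] (hpos : ∀ v, 0 < H.degree v)
    (hdegree : ∀ u v, H.Adj u v → H.degree u = H.degree v) :
    Matrix.of (fun u v => H.adjMatrix ℚ u v / H.degree u) ∈ doublyStochastic ℚ V := by
  have hsum : ∀ u, ∑ v, H.adjMatrix ℚ u v / H.degree u = 1 := by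
    intro u
    have hne : (H.degree u : ℚ) ≠ 0 := Nat.cast_ne_zero.2 (hpos u).ne'
    rw [← Finset.sum_div, div_eq_one_iff_eq hne]
    simp [adjMatrix_apply, Finset.sum_boole, ← card_neighborFinset_eq_degree,
      neighborFinset_eq_filter]
  have hsymm : ∀ u v, H.adjMatrix ℚ u v / H.degree u = H.adjMatrix ℚ v u / H.degree v := by
    intro u v
    simp only [adjMatrix_apply, H.adj_comm v u]
    split_ifs with huv
    · rw [hdegree u v huv]
    · rw [zero_div, zero_div]
  refine mem_doublyStochastic_iff_sum.2 ⟨fun u v => ?_, hsum, fun v => ?_⟩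
  · rw [Matrix.of_apply, adjMatrix_apply]
    positivity
  · simpa only [Matrix.of_apply, hsymm _ v] using hsum v

theorem mem_of_adj_of_ncard_le [Finite V] (hisolated : ∀ v, ∃ w, H.Adj v w)
    (hdegree : ∀ u v, H.Adj u v → (H.neighborSet u).ncard = (H.neighborSet v).ncard)
    {I Y : Set V} (hI : ∀ u ∈ I, H.neighborSet u ⊆ Y) (hcard : Y.ncard ≤ I.ncard) {y v : V}
    (hy : y ∈ Y) (hyv : H.Adj y v) : v ∈ I := by
  classical
  have := Fintype.ofFinite V
  have hncard : ∀ v, (H.neighborSet v).ncard = H.degree v := fun v => by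
    rw [← card_neighborSet_eq_degree, ← Nat.card_eq_fintype_card, Nat.card_coe_set_eq]
  have hpos : ∀ v, 0 < H.degree v := fun v => (H.degree_pos_iff_exists_adj v).2 (hisolated v)
  simp only [hncard] at hdegree
  rw [Set.ncard_eq_toFinset_card', Set.ncard_eq_toFinset_card'] at hcard
  by_contra hv
  have hzero := eq_zero_of_mem_doublyStochastic
    (adjMatrix_div_degree_mem_doublyStochastic hpos hdegree) hcard
    (fun u hu w hw => ?_) (i := v) (j := y) (by simpa using hv) (by simpa using hy)
  · rw [Matrix.of_apply, adjMatrix_apply, if_pos hyv.symm] at hzero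
    exact one_div_ne_zero (Nat.cast_ne_zero.2 (hpos v).ne') hzero
  · have huw : ¬ H.Adj u w := fun h => hw (Set.mem_toFinset.2 (hI u (Set.mem_toFinset.1 hu) h))
    rw [Matrix.of_apply, adjMatrix_apply, if_neg huw, zero_div]

end Weights

section Sachs

variable {V : Type*} {G H : SimpleGraph V}

theorem ncard_neighborSet_completeGraph_two (v : Fin 2) :
    ((completeGraph (Fin 2)).neighborSet v).ncard = 1 := by
  rw [← Nat.card_coe_set_eq, Nat.card_eq_fintype_card, card_neighborSet_eq_degree]
  simp

theorem ncard_neighborSet_cycleGraph {n : ℕ} (hn : 3 ≤ n) (v : Fin n) :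
    ((cycleGraph n).neighborSet v).ncard = 2 := by
  obtain ⟨m, rfl⟩ := Nat.exists_eq_add_of_le' hn
  rw [← Nat.card_coe_set_eq, Nat.card_eq_fintype_card, card_neighborSet_eq_degree,
    cycleGraph_degree_three_le]

theorem ncard_neighborSet_of_iso {K : H.ConnectedComponent} {W : Type*} {F : SimpleGraph W}
    (φ : K.toSimpleGraph ≃g F) {v : V} (hv : v ∈ K.supp) :
    (H.neighborSet v).ncard = (F.neighborSet (φ ⟨v, hv⟩)).ncard := by
  have himage : H.neighborSet v = Subtype.val '' K.toSimpleGraph.neighborSet ⟨v, hv⟩ := by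
    ext w
    exact ⟨fun h => ⟨⟨w, K.mem_supp_of_adj_mem_supp hv h⟩, h, rfl⟩, fun ⟨_, h, hw⟩ => hw ▸ h⟩
  rw [himage, Set.ncard_image_of_injective _ Subtype.val_injective, ← Nat.card_coe_set_eq,
    ← Nat.card_coe_set_eq, Nat.card_congr (φ.mapNeighborSet ⟨v, hv⟩)]

theorem IsSachs.exists_ncard_neighborSet_eq (hH : IsSachs G H) (K : H.ConnectedComponent) :
    ∃ d, 0 < d ∧ ∀ v ∈ K.supp, (H.neighborSet v).ncard = d := by
  rcases hH.2 K with ⟨⟨φ⟩⟩ | ⟨n, hn, ⟨φ⟩⟩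
  · exact ⟨1, one_pos, fun v hv => (ncard_neighborSet_of_iso φ hv).trans
      (ncard_neighborSet_completeGraph_two _)⟩
  · exact ⟨2, two_pos, fun v hv => (ncard_neighborSet_of_iso φ hv).trans
      (ncard_neighborSet_cycleGraph hn _)⟩

theorem IsSachs.exists_adj (hH : IsSachs G H) (v : V) : ∃ w, H.Adj v w := by
  obtain ⟨d, hd, hK⟩ := hH.exists_ncard_neighborSet_eq (H.connectedComponentMk v)
  exact Set.nonempty_of_ncard_ne_zero (hK v rfl ▸ hd.ne')

theorem IsSachs.ncard_neighborSet_eq_of_adj (hH : IsSachs G H) {u v : V} (huv : H.Adj u v) :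
    (H.neighborSet u).ncard = (H.neighborSet v).ncard := by
  obtain ⟨d, -, hK⟩ := hH.exists_ncard_neighborSet_eq (H.connectedComponentMk v)
  rw [hK u (ConnectedComponent.sound huv.reachable), hK v rfl]

theorem mem_of_adj_of_boundary_subset_geA [Finite V] (hHG : H ≤ G)
    (hisolated : ∀ v, ∃ w, H.Adj v w)
    (hdegree : ∀ u v, H.Adj u v → (H.neighborSet u).ncard = (H.neighborSet v).ncard) {S : Set V}
    (hS : IsAlmostBipartite (G.induce S))
    (hreach : ∀ C : (G.induce S).Subgraph, IsOddCycle C → reachSet C = Set.univ)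
    (hboundary : boundary G S ⊆ Subtype.val '' geA (G.induce S)) {u v : V} (hu : u ∈ S)
    (huv : H.Adj u v) : v ∈ S := by
  obtain ⟨I, Y, hAY, hIY, hI, hcard⟩ := hS.exists_ncard_le_of_reachSet hreach
  have hY {x : S} {w : V} (hw : w ∉ S) (hxw : H.Adj x w) : x ∈ Y := by
    obtain ⟨x', hx', heq⟩ := hboundary ⟨x.2, w, hw, hHG hxw⟩
    exact Subtype.ext heq ▸ hAY hx'
  have hIY' : ∀ x ∈ Subtype.val '' I, H.neighborSet x ⊆ Subtype.val '' Y := by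
    rintro _ ⟨x, hx, rfl⟩ w hxw
    by_cases hw : w ∈ S
    · exact ⟨⟨w, hw⟩, hI x hx (hHG hxw), rfl⟩
    · exact absurd (hY hw hxw) (Set.disjoint_left.1 hIY hx)
  by_contra hv
  obtain ⟨x, -, rfl⟩ := mem_of_adj_of_ncard_le hisolated hdegree hIY'
    (by simpa only [Set.ncard_image_of_injective _ Subtype.val_injective])
    (Set.mem_image_of_mem _ (hY (x := ⟨u, hu⟩) hv huv)) huv
  exact hv x.2

theorem supp_subset_of_mem_of_adj_closed {K : H.ConnectedComponent} {S : Set V}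
    (hS : ∀ u ∈ S, ∀ v, H.Adj u v → v ∈ S) {u : V} (huK : u ∈ K.supp) (hu : u ∈ S) :
    K.supp ⊆ S := by
  intro v hv
  obtain ⟨p⟩ := K.reachable_of_mem_supp huK hv
  clear hv huK
  induction p with
  | nil => exact hu
  | cons h _ ih => exact ih (hS _ hu _ h)

end Sachs

end BABGraph

theorem mainTheorem2_general {V ι : Type*} [Finite V] {G : SimpleGraph V} {VB : Set V}
    {VG : ι → Set V} (hcover : VB ∪ ⋃ i, VG i = Set.univ)
    (halmost : ∀ i, BABGraph.IsAlmostBipartite (G.induce (VG i)))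
    (hreach : ∀ i, ∀ C : (G.induce (VG i)).Subgraph,
      BABGraph.IsOddCycle C → BABGraph.reachSet C = Set.univ)
    (hboundary : ∀ i,
      BABGraph.boundary G (VG i) ⊆ Subtype.val '' BABGraph.geA (G.induce (VG i)))
    {H : SimpleGraph V} (hHG : H ≤ G) (hisolated : ∀ v, ∃ w, H.Adj v w)
    (hdegree : ∀ u v, H.Adj u v → (H.neighborSet u).ncard = (H.neighborSet v).ncard)
    (K : H.ConnectedComponent) : K.supp ⊆ VB ∨ ∃ i, K.supp ⊆ VG i := by
  by_cases hK : ∃ i, ∃ u ∈ K.supp, u ∈ VG i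
  · obtain ⟨i, u, huK, hu⟩ := hK
    refine .inr ⟨i, BABGraph.supp_subset_of_mem_of_adj_closed (fun x hx y hxy => ?_) huK hu⟩
    exact BABGraph.mem_of_adj_of_boundary_subset_geA hHG hisolated hdegree (halmost i) (hreach i)
      (hboundary i) hx hxy
  · refine .inl fun v hv => (hcover.ge (Set.mem_univ v)).resolve_right fun hvG => hK ?_
    obtain ⟨i, hi⟩ := Set.mem_iUnion.1 hvG
    exact ⟨i, v, hv, hi⟩

theorem mainTheorem2 {V : Type*} [Finite V] (G : SimpleGraph V) (k : ℕ)
    (VB : Set V) (VG : Fin k → Set V) (hG : BABGraph.IsBAB G VB VG)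
    (H : SimpleGraph V) (hH : BABGraph.IsSachs G H) (K : H.ConnectedComponent) :
    K.supp ⊆ VB ∨ ∃ i, K.supp ⊆ VG i :=
  mainTheorem2_general hG.cover hG.almostBipartite hG.reach hG.boundary_parts hH.1 hH.exists_adj
    (fun _ _ => hH.ncard_neighborSet_eq_of_adj) K
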